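/- For $d\in\mathbb{N}$, a symmetry on $\mathbb{C}^d$ is a matrix $J\in M_d(\mathbb{C})$ with $J=J^*=J^{-1}$, and $\mathrm{Sym}_3(\mathbb{C}^d)$ is the set of products $J_1J_2J_3$ of three symmetries on $\mathbb{C}^d$. Let $\mathbb{T}=\{z\in\mathbb{C}:|z|=1\}$. Let $d\ge 4$ be an even integer and $r=d/2$. Let $\alpha\neq\beta$ in $\mathbb{T}$ satisfy Condition (P): $\alpha^r\beta^r\in\{-1,1\}$, and whenever $i,j\ge 1$ are integers with $\alpha^i\beta^j\in\{-1,1\}$, then $i+j\ge d$. Let $V=\alpha I_r\oplus\beta I_r$, a unitary matrix on $\mathbb{C}^d$. Then $V\in\mathrm{Sym}_3(\mathbb{C}^d)$ if and only if at least one of the following three conditions holds: (i) $4\mid d$, $(\alpha\beta)^r=-1$, and $\left|e^{i\pi\frac{r-1}{r}}-1\right|<|\alpha-\beta|$; (ii) $4\nmid d$ and $\left|e^{i\pi\frac{r-1}{r}}-1\right|<|\alpha-\beta|$; (iii) $4\nmid d$, $(\alpha\beta)^r=-1$, and $\left|1-\alpha^{2j+1}\beta^{2j-1}\right|<|\alpha-\beta|$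 for all integers $1\le j\le r-1$. -/

import Mathlib

/-- A symmetry in a unital `*`-algebra: `J = J* = J⁻¹`. -/
structure IsSymmetry {A : Type*} [Monoid A] [Star A] (J : A) : Prop where
  star_eq : star J = J
  mul_self : J * J = 1

/-- The set of products `J₁ J₂ ⋯ J_k` of `k` symmetries of `A`. For `A = Matrix n n ℂ`, whose star
is the conjugate transpose, this is the set of products of `k` symmetries on `ℂⁿ`. -/
def symProducts (k : ℕ) (A : Type*) [Monoid A] [Star A] : Set A :=
  {V | ∃ J : Fin k → A, (∀ i, IsSymmetry (J i)) ∧ V = (List.ofFn J).prod}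

/-- Condition (P) for `α, β` and `d = r + s`; here `i, j` range over the positive integers. -/
structure ConditionP (r s : ℕ) (α β : ℂ) : Prop where
  det_real : α ^ r * β ^ s = -1 ∨ α ^ r * β ^ s = 1
  minimal : ∀ i j : ℕ, 1 ≤ i → 1 ≤ j →
    (α ^ i * β ^ j = -1 ∨ α ^ i * β ^ j = 1) → r + s ≤ i + j

/-- The diagonal matrix `α I_r ⊕ β I_s` on `ℂ^{r+s} = ℂ^r ⊕ ℂ^s`. -/
def twoScalarSum (r s : ℕ) (α β : ℂ) : Matrix (Fin r ⊕ Fin s) (Fin r ⊕ Fin s) ℂ :=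
  Matrix.fromBlocks (α • 1) 0 0 (β • 1)

open Matrix

/-! Under Condition (P), each of the three conditions amounts to `2 cos(π/(2r)) < ‖α - β‖`, and this
is the criterion proved (`ConditionP.mem_symProducts_three_iff`).

Necessity: if `V = J K L`, then `W = J V = K L` has spectrum closed under `z ↦ z⁻¹`. If `W x = z x`,
then `x` and `J x` span a `W`-invariant space, so `-αβ/z` is also an eigenvalue unless `z² ∈ {α²,
β²}`, and `‖z - αβ/z‖ ≤ ‖α - β‖`. The two moves together multiply `z²` by `(αβ)²`, a primitive
`r`-th root of unity. Condition (P) lets the resulting `r`-cycle break in at most one place, so the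
squares of eigenvalues contain a full regular `r`-gon (`ConditionP.two_mul_cos_le`). Some vertex
makes `‖z - αβ/z‖ ≥ 2 cos(π/(2r))`. Equality with `‖α - β‖` would contradict (P)
(`ConditionP.norm_sub_ne`).

Sufficiency: a 2×2 reflection times `diag(α, β)` can have any unit eigenvalues `z, w` with `zw =
-αβ` and `‖z + w‖ ≤ ‖α - β‖`. Choosing `r` such pairs along a geometric progression makes the total
spectrum invariant under conjugation, hence that of a product of two symmetries
(`ConditionP.twoScalarSum_mem`). -/

/-! ### Chord lengths on the unit circle -/

theorem Complex.norm_one_add_exp_mul_I (θ : ℝ) :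
    ‖1 + Complex.exp (θ * Complex.I)‖ = 2 * |Real.cos (θ / 2)| := by
  have h := Complex.norm_exp_I_mul_ofReal_sub_one (θ + Real.pi)
  have e : Complex.exp (Complex.I * ((θ + Real.pi : ℝ) : ℂ)) - 1
      = -(1 + Complex.exp (θ * Complex.I)) := by
    have : Complex.I * ((θ + Real.pi : ℝ) : ℂ) = θ * Complex.I + Real.pi * Complex.I := by
      push_cast; ring
    rw [this, Complex.exp_add, Complex.exp_pi_mul_I]; ring
  rw [e, norm_neg] at h
  rw [h, add_div, Real.sin_add_pi_div_two, Real.norm_eq_abs, abs_mul, abs_two]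

theorem Complex.norm_one_add_eq_two_mul_cos_arg {y : ℂ} (hy : ‖y‖ = 1) :
    ‖1 + y‖ = 2 * Real.cos (|y.arg| / 2) := by
  have e : Complex.exp (y.arg * Complex.I) = y := by
    simpa [hy] using Complex.norm_mul_exp_arg_mul_I y
  have h := Complex.norm_one_add_exp_mul_I y.arg
  rw [e] at h
  have habs := Complex.abs_arg_le_pi y
  rw [h, ← Real.cos_abs, abs_div, abs_two, abs_of_nonneg]
  exact Real.cos_nonneg_of_neg_pi_div_two_le_of_le (by linarith [abs_nonneg y.arg, Real.pi_pos])
    (by linarith)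

theorem norm_exp_sub_one_eq_two_mul_cos {r : ℕ} (hr : 0 < r) :
    ‖Complex.exp (Complex.I * (((r : ℂ) - 1) / (r : ℂ)) * (Real.pi : ℂ)) - 1‖
      = 2 * Real.cos (Real.pi / r / 2) := by
  have hr' : (r : ℂ) ≠ 0 := by exact_mod_cast hr.ne'
  have e : Complex.exp (Complex.I * (((r : ℂ) - 1) / (r : ℂ)) * (Real.pi : ℂ)) - 1
      = -(1 + Complex.exp (((-(Real.pi / r) : ℝ) : ℂ) * Complex.I)) := by
    have : Complex.I * (((r : ℂ) - 1) / (r : ℂ)) * (Real.pi : ℂ)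
        = ((-(Real.pi / r) : ℝ) : ℂ) * Complex.I + Real.pi * Complex.I := by
      push_cast; field_simp; ring
    rw [this, Complex.exp_add, Complex.exp_pi_mul_I]; ring
  have h1 : (1 : ℝ) ≤ r := by exact_mod_cast hr
  have h2 : Real.pi / r ≤ Real.pi := div_le_self Real.pi_pos.le h1
  have h3 : 0 < Real.pi / r := by positivity
  rw [e, norm_neg, Complex.norm_one_add_exp_mul_I, neg_div, Real.cos_neg, abs_of_nonneg]
  exact Real.cos_nonneg_of_neg_pi_div_two_le_of_le (by linarith) (by linarith)

/-- An argument smaller than `π/r` in absolute value cannot reach `±π` after multiplication by `r`.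
-/
theorem norm_one_add_le_of_pow_eq_neg_one {r : ℕ} (hr : 0 < r) {y : ℂ} (h : y ^ r = -1) :
    ‖1 + y‖ ≤ 2 * Real.cos (Real.pi / r / 2) := by
  have hy : ‖y‖ = 1 := by
    have : ‖y‖ ^ r = 1 := by rw [← norm_pow, h]; simp
    exact (pow_eq_one_iff_of_nonneg (norm_nonneg y) hr.ne').1 this
  have e : Complex.exp (y.arg * Complex.I) = y := by
    simpa [hy] using Complex.norm_mul_exp_arg_mul_I y
  rw [Complex.norm_one_add_eq_two_mul_cos_arg hy]
  have hr0 : (0 : ℝ) < r := by exact_mod_cast hr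
  have habs := Complex.abs_arg_le_pi y
  have hle : Real.pi / r ≤ |y.arg| := by
    by_contra hlt
    push Not at hlt
    have hlt' : |(r : ℝ) * y.arg| < Real.pi := by
      rw [abs_mul, abs_of_pos hr0]
      rwa [lt_div_iff₀ hr0, mul_comm] at hlt
    have hcos : Real.cos (r * y.arg) = -1 := by
      have h5 : Complex.exp (((r * y.arg : ℝ) : ℂ) * Complex.I) = -1 := by
        rw [← h, ← e, ← Complex.exp_nat_mul, e]; congr 1; push_cast; ring
      have := congrArg Complex.re h5
      rwa [Complex.exp_ofReal_mul_I_re, Complex.neg_re, Complex.one_re] at this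
    have : Real.cos Real.pi < Real.cos |(r : ℝ) * y.arg| :=
      Real.cos_lt_cos_of_nonneg_of_le_pi (abs_nonneg _) le_rfl hlt'
    rw [Real.cos_pi, Real.cos_abs, hcos] at this
    exact lt_irrefl _ this
  have := Real.cos_le_cos_of_nonneg_of_le_pi (x := Real.pi / r / 2) (y := |y.arg| / 2)
    (by positivity) (by linarith [Real.pi_pos]) (by linarith)
  linarith

/-- Among the vertices of a regular `r`-gon inscribed in the unit circle, one is within angle
`π / r` of `-1`. -/
theorem IsPrimitiveRoot.exists_le_norm_one_sub_mul_pow {r : ℕ} (hr : 0 < r) {ζ z : ℂ}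
    (hζ : IsPrimitiveRoot ζ r) (hz : ‖z‖ = 1) :
    ∃ k < r, 2 * Real.cos (Real.pi / r / 2) ≤ ‖1 - z * ζ ^ k‖ := by
  have hr0 : (0 : ℝ) < r := by exact_mod_cast hr
  have hrc : (r : ℂ) ≠ 0 := by exact_mod_cast hr.ne'
  have : NeZero r := ⟨hr.ne'⟩
  set θ := (-z).arg
  have e : Complex.exp (θ * Complex.I) = -z := by
    simpa [hz] using Complex.norm_mul_exp_arg_mul_I (-z)
  -- `2πm/r` is the multiple of `2π/r` nearest to the argument of `-z`, and `δ` is the remaining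
  -- angle.
  set m : ℤ := round (θ * r / (2 * Real.pi))
  have hm : |θ * r / (2 * Real.pi) - m| ≤ 1 / 2 := abs_sub_round _
  set δ : ℝ := θ - 2 * Real.pi * m / r with hδ
  have hδle : |δ| ≤ Real.pi / r := by
    have : δ = (θ * r / (2 * Real.pi) - m) * (2 * Real.pi / r) := by
      rw [hδ]; field_simp
    rw [this, abs_mul, abs_of_pos (by positivity : 0 < 2 * Real.pi / r)]
    calc _ ≤ 1 / 2 * (2 * Real.pi / r) := by gcongr
      _ = Real.pi / r := by ring
  obtain ⟨k, hk, hkξ⟩ := hζ.eq_pow_of_pow_eq_one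
    (ξ := Complex.exp (((-(2 * Real.pi * m / r) : ℝ) : ℂ) * Complex.I)) (by
      rw [← Complex.exp_nat_mul, Complex.exp_eq_one_iff]
      exact ⟨-m, by push_cast; field_simp⟩)
  refine ⟨k, hk, ?_⟩
  have h2 : 1 - z * ζ ^ k = 1 + Complex.exp (δ * Complex.I) := by
    rw [hkξ, sub_eq_add_neg, ← neg_mul, ← e, ← Complex.exp_add, hδ]
    congr 2; push_cast; ring
  rw [h2, Complex.norm_one_add_exp_mul_I, ← Real.cos_abs (δ / 2), abs_div, abs_two]
  have h1 : (1 : ℝ) ≤ r := by exact_mod_cast hr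
  have h4 : Real.pi / r ≤ Real.pi := div_le_self Real.pi_pos.le h1
  have := Real.cos_le_cos_of_nonneg_of_le_pi (x := |δ| / 2) (y := Real.pi / r / 2)
    (by positivity) (by linarith [Real.pi_pos]) (by linarith)
  linarith [le_abs_self (Real.cos (|δ| / 2))]

/-! ### Arithmetic consequences of Condition (P) -/

theorem ConditionP.symm {r s : ℕ} {α β : ℂ} (h : ConditionP r s α β) : ConditionP s r β α where
  det_real := by simpa only [mul_comm] using h.det_real
  minimal i j hi hj hij := by
    have := h.minimal j i hj hi (by simpa only [mul_comm] using hij)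
    omega

theorem ConditionP.le_of_sq_eq_one {r s : ℕ} {α β : ℂ} (h : ConditionP r s α β) {i j : ℕ}
    (hi : 1 ≤ i) (hj : 1 ≤ j) (hij : (α ^ i * β ^ j) ^ 2 = 1) : r + s ≤ i + j :=
  h.minimal i j hi hj (sq_eq_one_iff.1 hij).symm

theorem ConditionP.sq_det_eq_one {r s : ℕ} {α β : ℂ} (h : ConditionP r s α β) :
    (α ^ r * β ^ s) ^ 2 = 1 :=
  sq_eq_one_iff.2 h.det_real.symm

theorem ConditionP.isPrimitiveRoot {r : ℕ} (hr : 0 < r) {α β : ℂ} (h : ConditionP r r α β) :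
    IsPrimitiveRoot ((α * β) ^ 2) r := by
  refine IsPrimitiveRoot.mk_of_lt _ hr ?_ fun l hl hlr hl1 => ?_
  · rw [← h.sq_det_eq_one]; ring
  · have := h.le_of_sq_eq_one hl hl (by rw [← hl1]; ring)
    omega

/-- Otherwise `β` could be dropped twice from `α ^ r * β ^ r` without changing its square, against
minimality. For `r = 2` the exponent `r - 2` is not positive, so that case is treated by hand. -/
theorem ConditionP.pow_four_ne_one {r : ℕ} (hr : 2 ≤ r) {α β : ℂ} (h : ConditionP r r α β) :
    β ^ 4 ≠ 1 := by
  intro hβ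
  have hdet := h.sq_det_eq_one
  rcases hr.eq_or_lt with rfl | hr
  · have hα : (α ^ 2) ^ 2 = 1 := by
      linear_combination hdet - α ^ 4 * hβ
    have h21 := h.le_of_sq_eq_one (i := 2) (j := 1) (by simp) (by simp)
    have h12 := h.le_of_sq_eq_one (i := 1) (j := 2) (by simp) (by simp)
    have h11 := h.le_of_sq_eq_one (i := 1) (j := 1) (by simp) (by simp)
    rcases sq_eq_one_iff.1 (show (β ^ 2) ^ 2 = 1 by linear_combination hβ) with hb | hb
    · have := h21 (by linear_combination α ^ 4 * hb + hα)
      omega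
    rcases sq_eq_one_iff.1 hα with ha | ha
    · have := h12 (by linear_combination β ^ 4 * ha + hβ)
      omega
    · have := h11 (by linear_combination β ^ 2 * ha - hb)
      omega
  · obtain ⟨t, rfl⟩ := Nat.exists_eq_add_of_lt hr
    have := h.le_of_sq_eq_one (i := 2 + t + 1) (j := t + 1) (by omega) (by omega) (by
      rw [← hdet]
      linear_combination (-(α ^ (2 + t + 1) * β ^ (t + 1)) ^ 2) * hβ)
    omega

theorem ConditionP.det_eq_neg_one_of_even {r : ℕ} (hr : 0 < r) {α β : ℂ}
    (h : ConditionP r r α β) (he : Even r) : (α * β) ^ r = -1 := by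
  have hdet := h.det_real
  rw [← mul_pow] at hdet
  refine hdet.resolve_right fun h1 => ?_
  obtain ⟨t, rfl⟩ := he
  have := h.le_of_sq_eq_one (i := t) (j := t) (by omega) (by omega) (by rw [← h1]; ring)
  omega

/-- Writing `(αβ)² = ζ ^ b` gives `α⁴ = ζ ^ (b + 1)`. With `c = r - b - 1`, the square of `α ^ (c +
2b) * β ^ c` is `ζ ^ (b * r) = 1`, although the exponents add up to only `2r - 2`. -/
theorem ConditionP.false_of_sq_eq_mul_sq {r : ℕ} (hr : 2 ≤ r) {α β ζ : ℂ}
    (h : ConditionP r r α β) (hζ : IsPrimitiveRoot ζ r) (hαβ : α ^ 2 = ζ * β ^ 2) : False := by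
  have : NeZero r := ⟨by omega⟩
  obtain ⟨b, hb, hbη⟩ := hζ.eq_pow_of_pow_eq_one (h.isPrimitiveRoot (by omega)).pow_eq_one
  have hα4 : α ^ 4 = ζ * ζ ^ b := by
    rw [hbη]; linear_combination α ^ 2 * hαβ
  obtain ⟨c, rfl⟩ : ∃ c, r = b + c + 1 := ⟨r - b - 1, by omega⟩
  rcases Nat.eq_zero_or_pos c with rfl | hc
  · refine h.symm.pow_four_ne_one hr ?_
    rw [hα4, ← pow_succ', ← hζ.pow_eq_one, add_zero]
  · have := h.le_of_sq_eq_one (i := c + 2 * b) (j := c) (by omega) hc (by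
      have e : (α ^ (c + 2 * b) * β ^ c) ^ 2 = ((α * β) ^ 2) ^ c * (α ^ 4) ^ b := by ring
      rw [e, hα4, ← hbη]
      have e2 : (ζ ^ b) ^ c * (ζ * ζ ^ b) ^ b = (ζ ^ (b + c + 1)) ^ b := by ring
      rw [e2, hζ.pow_eq_one, one_pow])
    have hb0 : b ≠ 0 := by
      rintro rfl
      have := h.le_of_sq_eq_one (i := 1) (j := 1) le_rfl le_rfl (by
        rw [pow_one, pow_one, ← hbη, pow_zero])
      omega
    omega

/-- Equality would force `-α/β` to have argument `±π/r`, so `(α/β)²` would be `exp(±2πi/r)`. -/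
theorem ConditionP.norm_sub_ne {r : ℕ} (hr : 2 ≤ r) {α β : ℂ} (hα : ‖α‖ = 1) (hβ : ‖β‖ = 1)
    (h : ConditionP r r α β) : 2 * Real.cos (Real.pi / r / 2) ≠ ‖α - β‖ := by
  intro heq
  have hβ0 : β ≠ 0 := by rintro rfl; simp at hβ
  have hα0 : α ≠ 0 := by rintro rfl; simp at hα
  have hr0 : (r : ℂ) ≠ 0 := by exact_mod_cast (by omega : r ≠ 0)
  set y : ℂ := -(α / β) with hy
  have hy1 : ‖y‖ = 1 := by simp [hy, hα, hβ]
  have hn : ‖α - β‖ = ‖1 + y‖ := by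
    have : α - β = -β * (1 + y) := by rw [hy]; field_simp; ring
    rw [this, norm_mul, norm_neg, hβ, one_mul]
  rw [hn, Complex.norm_one_add_eq_two_mul_cos_arg hy1] at heq
  have h1 : (1 : ℝ) ≤ r := by exact_mod_cast (by omega : 1 ≤ r)
  have h4 : Real.pi / r ≤ Real.pi := div_le_self Real.pi_pos.le h1
  have h5 : 0 ≤ Real.pi / r := by positivity
  have habs := Complex.abs_arg_le_pi y
  have harg : |y.arg| = Real.pi / r := by
    have := Real.injOn_cos (x₁ := Real.pi / r / 2) (x₂ := |y.arg| / 2)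
      ⟨by linarith, by linarith⟩ ⟨by positivity, by linarith [Real.pi_pos]⟩ (by linarith)
    linarith
  have e : Complex.exp (y.arg * Complex.I) = y := by
    simpa [hy1] using Complex.norm_mul_exp_arg_mul_I y
  have hζ := Complex.isPrimitiveRoot_exp r (by omega)
  have hy2 : y ^ 2 = Complex.exp (2 * y.arg * Complex.I) := by
    rw [← e, ← Complex.exp_nat_mul, e]; congr 1; push_cast; ring
  have hαβ : α ^ 2 = y ^ 2 * β ^ 2 := by rw [hy]; field_simp
  rcases (abs_eq h5).1 harg with h6 | h6
  · refine h.false_of_sq_eq_mul_sq hr hζ ?_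
    rw [hαβ, hy2, h6]; congr 2; push_cast; ring
  · refine h.symm.false_of_sq_eq_mul_sq hr hζ ?_
    rw [hαβ, hy2, h6, ← mul_assoc, ← Complex.exp_add]
    have : 2 * (Real.pi : ℂ) * Complex.I / r + 2 * ((-(Real.pi / r) : ℝ) : ℂ) * Complex.I = 0 := by
      push_cast; ring
    rw [this, Complex.exp_zero, one_mul]

/-! ### The orbit argument for the spectrum -/

theorem exists_lt_and_not_succ {p : ℕ → Prop} (h0 : p 0) {k : ℕ} (hk : ¬ p k) :
    ∃ j < k, p j ∧ ¬ p (j + 1) := by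
  by_contra! H
  have key : ∀ n ≤ k, p n := by
    intro n
    induction n with
    | zero => exact fun _ => h0
    | succ n ih => exact fun hn => H n hn (ih (by omega))
  exact hk (key k le_rfl)

theorem ConditionP.sq_mul_pow_ne_sq {r : ℕ} (hr : 2 ≤ r) {α β : ℂ} (hβ : β ≠ 0)
    (h : ConditionP r r α β) {k : ℕ} (hk : 0 < k) (hkr : k < r) :
    α ^ 2 * ((α * β) ^ 2) ^ k ≠ β ^ 2 := by
  intro e
  obtain ⟨c, rfl⟩ : ∃ c, k = c + 1 := ⟨k - 1, by omega⟩
  have hβ2 : β ^ 2 ≠ 0 := pow_ne_zero 2 hβ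
  have e' : (α ^ (c + 2) * β ^ c) ^ 2 = 1 := by
    apply mul_right_cancel₀ hβ2
    linear_combination e
  rcases Nat.eq_zero_or_pos c with rfl | hc
  · exact h.symm.pow_four_ne_one hr (by linear_combination e')
  · have := h.le_of_sq_eq_one (by omega) hc e'
    omega

/-- An `r`-cycle under multiplication by `(αβ)²` thus meets `{α², β²}` at most once, so it has at
most one broken link. -/
theorem ConditionP.ne_mul_pow {r : ℕ} (hr : 2 ≤ r) {α β : ℂ} (hα : α ≠ 0) (hβ : β ≠ 0)
    (h : ConditionP r r α β) {k : ℕ} (hk : 0 < k) (hkr : k < r) {x y : ℂ}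
    (hx : x = α ^ 2 ∨ x = β ^ 2) (hy : y = α ^ 2 ∨ y = β ^ 2) :
    x * ((α * β) ^ 2) ^ k ≠ y := by
  have hne := (h.isPrimitiveRoot (by omega)).pow_ne_one_of_pos_of_lt hk.ne' hkr
  rcases hx with rfl | rfl <;> rcases hy with rfl | rfl
  · exact fun e => hne (mul_left_cancel₀ (pow_ne_zero 2 hα) (by rw [e, mul_one]))
  · exact h.sq_mul_pow_ne_sq hr hβ hk hkr
  · simpa only [mul_comm] using h.symm.sq_mul_pow_ne_sq hr hα hk hkr
  · exact fun e => hne (mul_left_cancel₀ (pow_ne_zero 2 hβ) (by rw [e, mul_one]))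

/-- A nonempty set of unit complex numbers with the closure properties of the spectrum of `J V`,
where `J` is a symmetry, `J V` is a product of two symmetries and `V` has eigenvalues `α, β`,
forces a lower bound on `‖α - β‖`. -/
theorem ConditionP.two_mul_cos_le {r : ℕ} (hr : 2 ≤ r) {α β : ℂ} (hα : ‖α‖ = 1) (hβ : ‖β‖ = 1)
    (h : ConditionP r r α β) {S : Set ℂ} (hS : S.Nonempty)
    (hnorm : ∀ z ∈ S, ‖z‖ = 1) (hinv : ∀ z ∈ S, z⁻¹ ∈ S)
    (hstep : ∀ z ∈ S, z ^ 2 ≠ α ^ 2 → z ^ 2 ≠ β ^ 2 → -(α * β) / z ∈ S)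
    (hle : ∀ z ∈ S, ‖z - α * β / z‖ ≤ ‖α - β‖) :
    2 * Real.cos (Real.pi / r / 2) ≤ ‖α - β‖ := by
  have hβ0 : β ≠ 0 := by rintro rfl; simp at hβ
  have hα0 : α ≠ 0 := by rintro rfl; simp at hα
  have hS0 : ∀ z ∈ S, z ≠ 0 := by
    rintro z hz rfl
    simpa using hnorm 0 hz
  obtain ⟨z₀, hz₀⟩ := hS
  have hz₀0 := hS0 z₀ hz₀
  have hprim := h.isPrimitiveRoot (by omega)
  set s : ℕ → ℂ := fun k => z₀ ^ 2 * ((α * β) ^ 2) ^ k with hs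
  have hs1 : ∀ k, s (k + 1) = s k * (α * β) ^ 2 := fun k => by simp only [hs]; ring
  set B : ℕ → Prop := fun k => ∃ z ∈ S, z ^ 2 = s k with hB
  have up : ∀ k, B k → ¬ B (k + 1) → s (k + 1) = α ^ 2 ∨ s (k + 1) = β ^ 2 := by
    rintro k ⟨z, hz, hzk⟩ hn
    by_contra! hne
    have hz0 := hS0 z hz
    refine hn ⟨-(α * β) / z⁻¹, hstep _ (hinv z hz) ?_ ?_, ?_⟩
    · intro e
      apply hne.2
      rw [hs1, ← hzk]
      field_simp at e
      linear_combination -β ^ 2 * e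
    · intro e
      apply hne.1
      rw [hs1, ← hzk]
      field_simp at e
      linear_combination -α ^ 2 * e
    · rw [hs1, ← hzk]; field_simp
  have down : ∀ k, ¬ B k → B (k + 1) → s (k + 1) = α ^ 2 ∨ s (k + 1) = β ^ 2 := by
    rintro k hn ⟨z, hz, hzk⟩
    by_contra! hne
    have hz0 := hS0 z hz
    refine hn ⟨_, hinv _ (hstep z hz (hzk ▸ hne.1) (hzk ▸ hne.2)), ?_⟩
    rw [hs1] at hzk
    field_simp
    linear_combination hzk
  have hB0 : B 0 := ⟨z₀, hz₀, by simp [hs]⟩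
  have hBr : B r := ⟨z₀, hz₀, by simp [hs, hprim.pow_eq_one]⟩
  -- A gap in the cycle has a beginning and an end. These are two distinct broken links, both
  -- landing in `{α², β²}`.
  have hall : ∀ k < r, B k := by
    intro k hk
    by_contra hn
    obtain ⟨i, hik, hi, hi'⟩ := exists_lt_and_not_succ hB0 hn
    obtain ⟨j, hjk, hj, hj'⟩ := exists_lt_and_not_succ (p := fun n => ¬ B (k + n)) hn
      (k := r - k) (by rw [Nat.add_sub_cancel' hk.le]; exact not_not.2 hBr)
    have w1 := up i hi hi'
    have w2 := down (k + j) hj (not_not.1 hj')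
    refine h.ne_mul_pow hr hα0 hβ0 (k := k + j - i) (by omega) (by omega) w1 w2 ?_
    obtain ⟨n, hn⟩ : ∃ n, k + j = i + n := ⟨k + j - i, by omega⟩
    rw [hn, Nat.add_sub_cancel_left]
    simp only [hs]; ring
  obtain ⟨k, hk, hck⟩ := hprim.inv.exists_le_norm_one_sub_mul_pow (by omega)
    (z := α * β / z₀ ^ 2) (by simp [hα, hβ, hnorm z₀ hz₀])
  obtain ⟨z, hz, hzk⟩ := hall k hk
  refine hck.trans (le_trans (le_of_eq ?_) (hle z hz))
  have hz0 := hS0 z hz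
  have : z - α * β / z = z * (1 - α * β / z₀ ^ 2 * ((α * β) ^ 2)⁻¹ ^ k) := by
    have e : α * β / z₀ ^ 2 * ((α * β) ^ 2)⁻¹ ^ k = α * β / z ^ 2 := by
      rw [hzk]
      simp only [hs, inv_pow]
      field_simp
    rw [e]; field_simp
  rw [this, norm_mul, hnorm z hz, one_mul]

/-! ### Eigenvectors of a symmetry times a unitary -/

theorem eq_or_eq_of_apply_eq_smul {E : Type*} [NormedAddCommGroup E]
    [InnerProductSpace ℂ E] {V : E →L[ℂ] E} {α β : ℂ}
    (hV : V * V = (α + β) • V - (α * β) • 1) {x : E} (hx : x ≠ 0) {c : ℂ} (h : V x = c • x) :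
    c = α ∨ c = β := by
  have h2 : V (V x) = (α + β) • V x - (α * β) • x := by
    simpa using congrArg (fun A : E →L[ℂ] E => A x) hV
  rw [h, map_smul, h, smul_smul, smul_smul, ← sub_smul] at h2
  have h3 := smul_left_injective ℂ hx h2
  have h4 : (c - α) * (c - β) = 0 := by linear_combination h3
  rcases mul_eq_zero.1 h4 with h5 | h5
  · exact Or.inl (sub_eq_zero.1 h5)
  · exact Or.inr (sub_eq_zero.1 h5)

section Operators

variable {E : Type*} [NormedAddCommGroup E] [InnerProductSpace ℂ E] [CompleteSpace E]

theorem inner_apply_apply_of_star_mul_self {A : E →L[ℂ] E} (hA : star A * A = 1) (x y : E) :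
    inner ℂ (A x) (A y) = inner ℂ x y := by
  rw [← ContinuousLinearMap.adjoint_inner_right, ← ContinuousLinearMap.star_eq_adjoint,
    ← mul_apply_eq_comp, hA, one_apply_eq_self]

theorem norm_apply_of_star_mul_self {A : E →L[ℂ] E} (hA : star A * A = 1) (x : E) :
    ‖A x‖ = ‖x‖ := by
  have h := inner_apply_apply_of_star_mul_self hA x x
  rw [inner_self_eq_norm_sq_to_K, inner_self_eq_norm_sq_to_K] at h
  have h' : ‖A x‖ ^ 2 = ‖x‖ ^ 2 := by exact_mod_cast h
  exact (sq_eq_sq₀ (norm_nonneg _) (norm_nonneg _)).1 h'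

theorem norm_eq_one_of_apply_eq_smul {A : E →L[ℂ] E} (hA : star A * A = 1) {x : E} (hx : x ≠ 0)
    {z : ℂ} (h : A x = z • x) : ‖z‖ = 1 := by
  have := norm_apply_of_star_mul_self hA x
  rw [h, norm_smul] at this
  exact mul_right_cancel₀ (norm_ne_zero_iff.2 hx) (by rw [this, one_mul])

theorem IsSymmetry.apply_apply {J : E →L[ℂ] E} (hJ : IsSymmetry J) (x : E) : J (J x) = x := by
  rw [← mul_apply_eq_comp, hJ.mul_self, one_apply_eq_self]

theorem IsSymmetry.star_mul_self {J : E →L[ℂ] E} (hJ : IsSymmetry J) : star J * J = 1 := by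
  rw [hJ.star_eq, hJ.mul_self]

theorem IsSymmetry.mul_apply_apply_eq {J V : E →L[ℂ] E} (hJ : IsSymmetry J) {α β : ℂ}
    (hV : V * V = (α + β) • V - (α * β) • 1) {x : E} {z : ℂ} (hz : z ≠ 0)
    (h : (J * V) x = z • x) :
    (J * V) (J x) = (α + β) • x + (-(α * β) / z) • J x := by
  have h1 : V x = z • J x := by
    rw [← map_smul, ← h, mul_apply_eq_comp, hJ.apply_apply]
  have h2 : V (V x) = (α + β) • V x - (α * β) • x := by
    simpa using congrArg (fun A : E →L[ℂ] E => A x) hV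
  have h3 : V (J x) = (α + β) • J x + (-(α * β) / z) • x := by
    rw [h1, map_smul] at h2
    have h4 := congrArg (fun v => z⁻¹ • v) h2
    simp only [inv_smul_smul₀ hz] at h4
    rw [h4, smul_sub, smul_comm (α + β) z, inv_smul_smul₀ hz, smul_smul, sub_eq_add_neg,
      ← neg_smul]
    congr 2; field_simp
  rw [mul_apply_eq_comp, h3, map_add, map_smul, map_smul, hJ.apply_apply]

theorem IsSymmetry.exists_apply_eq_neg_div_smul {J V : E →L[ℂ] E} (hJ : IsSymmetry J) {α β : ℂ}
    (hV : V * V = (α + β) • V - (α * β) • 1) {x : E} (hx : x ≠ 0) {z : ℂ} (hz : z ≠ 0)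
    (h : (J * V) x = z • x) (hα : z ^ 2 ≠ α ^ 2) (hβ : z ^ 2 ≠ β ^ 2) :
    ∃ y ≠ 0, (J * V) y = (-(α * β) / z) • y := by
  have hy := hJ.mul_apply_apply_eq hV hz h
  set w := -(α * β) / z
  by_cases hzw : z = w
  · exact ⟨x, hx, by rw [h, hzw]⟩
  have hwz : w - z ≠ 0 := sub_ne_zero.2 (Ne.symm hzw)
  -- On the span of `x` and `J x` the operator is triangular with diagonal `z, w`; this is its
  -- `w`-eigenvector. It vanishes only if `x` is an eigenvector of `J`, hence of `V`.
  refine ⟨J x + ((α + β) / (w - z)) • x, fun h0 => ?_, ?_⟩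
  · set c := -((α + β) / (w - z))
    have hJx : J x = c • x := by
      rw [eq_neg_of_add_eq_zero_left h0, neg_smul]
    have hc : c ^ 2 = 1 := by
      have := hJ.apply_apply x
      rw [hJx, map_smul, hJx, smul_smul] at this
      exact smul_left_injective ℂ hx (by simpa [sq] using this)
    have hVx : V x = (z * c) • x := by
      rw [mul_smul, ← hJx, ← map_smul, ← h, mul_apply_eq_comp, hJ.apply_apply]
    rcases eq_or_eq_of_apply_eq_smul hV hx hVx with e | e
    · exact hα (by rw [← e, mul_pow, hc, mul_one])
    · exact hβ (by rw [← e, mul_pow, hc, mul_one])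
  · rw [map_add, map_smul, hy, h, smul_add, smul_smul, smul_smul,
      add_right_comm, ← add_smul, add_comm]
    congr 2; field_simp; ring

/-- Unitarity of `J V` gives `(z + αβ/z) ⟪x, J x⟫ = (α + β) ‖x‖²`, so Cauchy–Schwarz yields `‖α + β‖
≤ ‖z + αβ/z‖`. The parallelogram law turns sums into differences and reverses the inequality. -/
theorem IsSymmetry.norm_sub_div_le {J V : E →L[ℂ] E} (hJ : IsSymmetry J) {α β : ℂ}
    (hα : ‖α‖ = 1) (hβ : ‖β‖ = 1) (hVu : star V * V = 1)
    (hV : V * V = (α + β) • V - (α * β) • 1) {x : E} (hx : x ≠ 0) {z : ℂ}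
    (h : (J * V) x = z • x) : ‖z - α * β / z‖ ≤ ‖α - β‖ := by
  have hW : star (J * V) * (J * V) = 1 := by
    rw [star_mul, mul_assoc, ← mul_assoc (star J), hJ.star_mul_self, one_mul, hVu]
  have hz := norm_eq_one_of_apply_eq_smul hW hx h
  have hz0 : z ≠ 0 := by rintro rfl; simp at hz
  have hy := hJ.mul_apply_apply_eq hV hz0 h
  have hx0 : 0 < ‖x‖ := norm_pos_iff.2 hx
  have hin : z * inner ℂ x (J x) = inner ℂ x ((J * V) (J x)) := by
    have := inner_apply_apply_of_star_mul_self hW x (J x)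
    rw [h, inner_smul_left] at this
    rw [← this, ← mul_assoc, RCLike.mul_conj, hz]; simp
  rw [hy, inner_add_right, inner_smul_right, inner_smul_right, inner_self_eq_norm_sq_to_K] at hin
  have hin2 : (z + α * β / z) * inner ℂ x (J x) = (α + β) * (‖x‖ : ℂ) ^ 2 := by
    linear_combination hin
  have hcs : ‖inner ℂ x (J x)‖ ≤ ‖x‖ ^ 2 := by
    have := norm_inner_le_norm (𝕜 := ℂ) x (J x)
    rwa [norm_apply_of_star_mul_self hJ.star_mul_self, ← sq] at this
  have h1 : ‖α + β‖ ≤ ‖z + α * β / z‖ := by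
    have h2 := congrArg norm hin2
    rw [norm_mul, norm_mul, norm_pow, Complex.norm_real, norm_norm] at h2
    have h3 : ‖α + β‖ * ‖x‖ ^ 2 ≤ ‖z + α * β / z‖ * ‖x‖ ^ 2 := by
      rw [← h2]; gcongr
    exact le_of_mul_le_mul_right h3 (by positivity)
  have p1 := parallelogram_law_with_norm ℂ α β
  have p2 := parallelogram_law_with_norm ℂ z (α * β / z)
  rw [hα, hβ] at p1
  rw [norm_div, norm_mul, hα, hβ, hz] at p2
  refine le_of_sq_le_sq ?_ (norm_nonneg _)
  nlinarith [norm_nonneg (α + β), norm_nonneg (z + α * β / z)]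

theorem IsSymmetry.mul_apply_apply_eq_inv_smul {K L : E →L[ℂ] E} (hK : IsSymmetry K)
    (hL : IsSymmetry L) {x : E} {z : ℂ} (hz : z ≠ 0) (h : (K * L) x = z • x) :
    (K * L) (K x) = z⁻¹ • K x := by
  have h1 : L x = z • K x := by
    rw [← map_smul, ← h, mul_apply_eq_comp, hK.apply_apply]
  have h2 : L (K x) = z⁻¹ • x := by
    rw [eq_inv_smul_iff₀ hz, ← map_smul, ← h1, hL.apply_apply]
  rw [mul_apply_eq_comp, h2, map_smul]

theorem IsSymmetry.apply_ne_zero {K : E →L[ℂ] E} (hK : IsSymmetry K) {x : E} (hx : x ≠ 0) :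
    K x ≠ 0 := fun h => hx (by rw [← hK.apply_apply x, h, map_zero])

theorem ConditionP.two_mul_cos_le_of_eq_mul [FiniteDimensional ℂ E] [Nontrivial E]
    {r : ℕ} (hr : 2 ≤ r) {α β : ℂ} (hα : ‖α‖ = 1) (hβ : ‖β‖ = 1)
    (h : ConditionP r r α β) {J K L V : E →L[ℂ] E} (hJ : IsSymmetry J) (hK : IsSymmetry K)
    (hL : IsSymmetry L) (hVu : star V * V = 1) (hV : V * V = (α + β) • V - (α * β) • 1)
    (hprod : V = J * (K * L)) :
    2 * Real.cos (Real.pi / r / 2) ≤ ‖α - β‖ := by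
  have hW : star (J * V) * (J * V) = 1 := by
    rw [star_mul, mul_assoc, ← mul_assoc (star J), hJ.star_mul_self, one_mul, hVu]
  have hKL : J * V = K * L := by rw [hprod, ← mul_assoc, hJ.mul_self, one_mul]
  have hne : ∀ {x : E} {z : ℂ}, x ≠ 0 → (J * V) x = z • x → z ≠ 0 := by
    rintro x z hx hz rfl
    simpa using norm_eq_one_of_apply_eq_smul hW hx hz
  refine h.two_mul_cos_le hr hα hβ (S := {z | ∃ x ≠ 0, (J * V) x = z • x}) ?_ ?_ ?_ ?_ ?_
  · obtain ⟨c, hc⟩ := Module.End.exists_eigenvalue ((J * V : E →L[ℂ] E) : E →ₗ[ℂ] E)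
    obtain ⟨x, hx⟩ := hc.exists_hasEigenvector
    exact ⟨c, x, hx.2, hx.apply_eq_smul⟩
  · rintro z ⟨x, hx, hz⟩
    exact norm_eq_one_of_apply_eq_smul hW hx hz
  · rintro z ⟨x, hx, hz⟩
    refine ⟨K x, hK.apply_ne_zero hx, ?_⟩
    have hz0 := hne hx hz
    rw [hKL] at hz ⊢
    exact hK.mul_apply_apply_eq_inv_smul hL hz0 hz
  · rintro z ⟨x, hx, hz⟩ h1 h2
    exact hJ.exists_apply_eq_neg_div_smul hV hx (hne hx hz) hz h1 h2
  · rintro z ⟨x, hx, hz⟩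
    exact hJ.norm_sub_div_le hα hβ hVu hV hx hz

end Operators

/-! ### Two-dimensional building blocks -/

theorem Matrix.exists_unitary_diagonalization_fin_two {W : Matrix (Fin 2) (Fin 2) ℂ}
    (hW : W ∈ unitaryGroup (Fin 2) ℂ) {z w : ℂ} (hz : ‖z‖ = 1) (htr : W.trace = z + w)
    (hdet : W.det = z * w) :
    ∃ U ∈ unitaryGroup (Fin 2) ℂ, W = U * !![z, 0; 0, w] * star U := by
  have hsing : (W - z • (1 : Matrix (Fin 2) (Fin 2) ℂ)).det = 0 := by
    rw [det_fin_two] at hdet ⊢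
    rw [trace_fin_two] at htr
    simp
    linear_combination hdet - z * htr
  obtain ⟨v, hv0, hv⟩ := exists_mulVec_eq_zero_iff.2 hsing
  have e0 : W 0 0 * v 0 + W 0 1 * v 1 = z * v 0 := by
    have := congrFun hv 0
    simp [mulVec, dotProduct, Fin.sum_univ_two] at this
    linear_combination this
  have e1 : W 1 0 * v 0 + W 1 1 * v 1 = z * v 1 := by
    have := congrFun hv 1
    simp [mulVec, dotProduct, Fin.sum_univ_two] at this
    linear_combination this
  set N : ℝ := ‖v 0‖ ^ 2 + ‖v 1‖ ^ 2 with hN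
  have hNpos : 0 < N := by
    by_contra hle
    have h0 : ‖v 0‖ ^ 2 = 0 := by nlinarith [sq_nonneg ‖v 0‖, sq_nonneg ‖v 1‖]
    have h1 : ‖v 1‖ ^ 2 = 0 := by nlinarith [sq_nonneg ‖v 0‖, sq_nonneg ‖v 1‖]
    apply hv0
    ext i
    fin_cases i
    · simpa using h0
    · simpa using h1
  obtain ⟨t, ht0, ht⟩ : ∃ t : ℝ, 0 < t ∧ t ^ 2 * N = 1 :=
    ⟨(√N)⁻¹, by positivity, by rw [inv_pow, Real.sq_sqrt hNpos.le, inv_mul_cancel₀ hNpos.ne']⟩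
  set a : ℂ := t * v 0 with ha
  set b : ℂ := t * v 1 with hb
  have f0 : W 0 0 * a + W 0 1 * b = z * a := by linear_combination (t : ℂ) * e0
  have f1 : W 1 0 * a + W 1 1 * b = z * b := by linear_combination (t : ℂ) * e1
  have hab : star a * a + star b * b = 1 := by
    have h0 : star (v 0) * v 0 = (‖v 0‖ : ℂ) ^ 2 := Complex.conj_mul' _
    have h1 : star (v 1) * v 1 = (‖v 1‖ : ℂ) ^ 2 := Complex.conj_mul' _
    have h2 : (t : ℂ) ^ 2 * ((‖v 0‖ : ℂ) ^ 2 + (‖v 1‖ : ℂ) ^ 2) = 1 := by exact_mod_cast ht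
    have h3 : star (t : ℂ) = t := Complex.conj_ofReal t
    rw [ha, hb, star_mul', star_mul', h3]
    linear_combination (t : ℂ) ^ 2 * h0 + (t : ℂ) ^ 2 * h1 + h2
  -- A unit eigenvector completed to a unitary. Conjugation makes `W` triangular, and a triangular
  -- unitary is diagonal, even when `z = w`.
  set U : Matrix (Fin 2) (Fin 2) ℂ := !![a, -star b; b, star a] with hU
  have hUu : star U * U = 1 := by
    ext i j
    fin_cases i <;> fin_cases j <;>
      simp only [hU, star_eq_conjTranspose, mul_apply, Fin.sum_univ_two, conjTranspose_apply] <;>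
      simp [-RCLike.star_def, -Complex.star_def]
    · linear_combination hab
    · ring
    · ring
    · linear_combination hab
  have hUU : U * star U = 1 := mul_eq_one_comm.1 hUu
  set T := star U * W * U with hT
  have hTu : T * star T = 1 := by
    rw [hT, star_mul, star_mul, star_star]
    calc star U * W * U * (star U * (star W * U))
        = star U * (W * (U * star U) * star W) * U := by simp only [mul_assoc]
      _ = 1 := by rw [hUU, mul_one, mem_unitaryGroup_iff.1 hW, mul_one, hUu]
  have hTdet : T.det = z * w := by
    rw [hT, det_mul, det_mul, hdet, mul_right_comm, ← det_mul, hUu, det_one, one_mul]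
  have hT0 : T 0 0 = z := by
    simp only [hT, hU, star_eq_conjTranspose, mul_apply, Fin.sum_univ_two, conjTranspose_apply]
    simp [-RCLike.star_def, -Complex.star_def]
    linear_combination star a * f0 + star b * f1 + z * hab
  have hT1 : T 1 0 = 0 := by
    simp only [hT, hU, star_eq_conjTranspose, mul_apply, Fin.sum_univ_two, conjTranspose_apply]
    simp [-RCLike.star_def, -Complex.star_def]
    linear_combination -b * f0 + a * f1
  have hT2 : T 0 1 = 0 := by
    have h := congrFun (congrFun hTu 0) 0
    simp only [star_eq_conjTranspose, mul_apply, Fin.sum_univ_two, conjTranspose_apply, hT0,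
      one_apply_eq] at h
    have hzz : z * star z = 1 := by
      have : z * star z = (‖z‖ : ℂ) ^ 2 := Complex.mul_conj' _
      rw [this, hz]; simp
    rw [hzz] at h
    have : T 0 1 * star (T 0 1) = 0 := by linear_combination h
    rcases mul_eq_zero.1 this with h | h
    · exact h
    · exact star_eq_zero.1 h
  have hz0 : z ≠ 0 := by rintro rfl; simp at hz
  have hT3 : T 1 1 = w := by
    rw [det_fin_two, hT0, hT1, mul_zero, sub_zero] at hTdet
    exact mul_left_cancel₀ hz0 hTdet
  refine ⟨U, mem_unitaryGroup_iff.2 hUU, ?_⟩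
  have hTe : T = !![z, 0; 0, w] := by
    rw [eta_fin_two T, hT0, hT1, hT2, hT3]
  rw [← hTe, hT]
  calc W = (U * star U) * W * (U * star U) := by rw [hUU, one_mul, mul_one]
    _ = _ := by simp only [mul_assoc]

/-- For the reflection `J = !![c, s; s, -c]`, the product has determinant `-αβ` and trace `c (α -
β)`. So `c = (z + w)/(α - β)` is forced; it is real because `zw = -αβ`, and `|c| ≤ 1` is the norm
bound. -/
theorem Matrix.exists_isSymmetry_mul_eq {α β z w : ℂ} (hα : ‖α‖ = 1) (hβ : ‖β‖ = 1)
    (hαβ : α ≠ β) (hz : ‖z‖ = 1) (hw : ‖w‖ = 1) (hzw : z * w = -(α * β))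
    (hle : ‖z + w‖ ≤ ‖α - β‖) :
    ∃ J U : Matrix (Fin 2) (Fin 2) ℂ, IsSymmetry J ∧ U ∈ unitaryGroup (Fin 2) ℂ ∧
      J * !![α, 0; 0, β] = U * !![z, 0; 0, w] * star U := by
  have hstar : ∀ {x : ℂ}, ‖x‖ = 1 → x * star x = 1 := fun {x} hx => by
    have : x * star x = (‖x‖ : ℂ) ^ 2 := Complex.mul_conj' _
    rw [this, hx]; simp
  have hα' := hstar hα
  have hβ' := hstar hβ
  have hsub : α - β ≠ 0 := sub_ne_zero.2 hαβ
  obtain ⟨c, hc⟩ : ∃ c : ℝ, (c : ℂ) = (z + w) / (α - β) := by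
    refine ⟨((z + w) / (α - β)).re, Complex.conj_eq_iff_re.1 ?_⟩
    have hsub' : star α - star β ≠ 0 := by
      rw [← star_sub]; exact star_ne_zero.2 hsub
    have key : (star z + star w) * (α - β) = (z + w) * (star α - star β) := by
      have hz' := hstar hz
      have hw' := hstar hw
      have h1 : star z + star w = -(z + w) * (star α * star β) := by
        have : star z * star w = -(star α * star β) := by
          rw [← star_mul', hzw, star_neg, star_mul']
        linear_combination (z + w) * this - star w * hz' - star z * hw'
      rw [h1]
      linear_combination (-(z + w) * star β) * hα' + ((z + w) * star α) * hβ'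
    have : (starRingEnd ℂ) ((z + w) / (α - β)) = (star z + star w) / (star α - star β) := by
      simp
    rw [this, div_eq_div_iff hsub' hsub, key]
  have hc1 : c ^ 2 ≤ 1 := by
    have : |c| ≤ 1 := by
      rw [← Real.norm_eq_abs, ← Complex.norm_real, hc, norm_div]
      exact div_le_one_of_le₀ hle (norm_nonneg _)
    exact (sq_le_one_iff_abs_le_one c).2 this
  obtain ⟨s, hs⟩ : ∃ s : ℝ, c ^ 2 + s ^ 2 = 1 :=
    ⟨√(1 - c ^ 2), by rw [Real.sq_sqrt (by linarith)]; ring⟩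
  have hs' : (c : ℂ) ^ 2 + (s : ℂ) ^ 2 = 1 := by exact_mod_cast hs
  set J : Matrix (Fin 2) (Fin 2) ℂ := !![(c : ℂ), s; s, -c] with hJ
  have hJs : IsSymmetry J := by
    constructor
    · ext i j
      fin_cases i <;> fin_cases j <;> simp [hJ]
    · rw [hJ, mul_fin_two, one_fin_two]
      ext i j
      fin_cases i <;> fin_cases j <;> simp
      · linear_combination hs'
      · ring
      · ring
      · linear_combination hs'
  have hVu : (!![α, 0; 0, β] : Matrix (Fin 2) (Fin 2) ℂ) * star !![α, 0; 0, β] = 1 := by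
    ext i j
    fin_cases i <;> fin_cases j <;>
      simp [star_eq_conjTranspose, mul_apply, Fin.sum_univ_two, -RCLike.star_def, -Complex.star_def, hα', hβ']
  obtain ⟨U, hU, hUW⟩ := exists_unitary_diagonalization_fin_two
    (W := J * !![α, 0; 0, β]) (z := z) (w := w) (by
      rw [mem_unitaryGroup_iff, star_mul, mul_assoc, ← mul_assoc !![α, 0; 0, β], hVu, one_mul,
        hJs.star_eq, hJs.mul_self]) hz (by
      rw [eq_div_iff hsub] at hc
      simp [hJ, trace_fin_two]
      linear_combination hc) (by
      rw [det_mul, hJ, det_fin_two_of, det_fin_two_of, hzw]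
      linear_combination -(α * β) * hs')
  exact ⟨J, U, hJs, hU, hUW⟩

/-! ### Assembling blocks into a product of three symmetries -/

theorem IsSymmetry.conj {A : Type*} [Monoid A] [StarMul A] {J U : A} (hJ : IsSymmetry J)
    (hU : star U * U = 1) (hU' : U * star U = 1) : IsSymmetry (U * J * star U) where
  star_eq := by simp only [star_mul, star_star, hJ.star_eq, mul_assoc]
  mul_self := by
    calc U * J * star U * (U * J * star U)
        = U * (J * (star U * U) * J) * star U := by simp only [mul_assoc]
      _ = 1 := by rw [hU, mul_one, hJ.mul_self, mul_one, hU']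

/-- A unitary diagonal matrix whose diagonal is permuted by an involution into its conjugate is a
product of two symmetries. -/
theorem Matrix.exists_isSymmetry_diagonal_eq_mul {ι : Type*} [Fintype ι] [DecidableEq ι]
    {D : ι → ℂ} (hD : ∀ i, D i * star (D i) = 1) {σ : Equiv.Perm ι} (hσ : Function.Involutive σ)
    (h : ∀ i, D (σ i) = star (D i)) :
    ∃ K L : Matrix ι ι ℂ, IsSymmetry K ∧ IsSymmetry L ∧ diagonal D = K * L := by
  have hσσ : σ * σ = 1 := Equiv.ext hσ
  have hσi : σ⁻¹ = σ := inv_eq_of_mul_eq_one_left hσσ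
  set P : Matrix ι ι ℂ := σ.permMatrix ℂ with hP
  have hPs : IsSymmetry P :=
    ⟨by rw [star_eq_conjTranspose, hP, conjTranspose_permMatrix, hσi],
      by rw [hP, ← permMatrix_mul, hσσ, permMatrix_one]⟩
  have hcomm : diagonal (star D) * P = P * diagonal D := by
    ext i j
    rw [diagonal_mul, mul_diagonal, hP, Equiv.Perm.permMatrix, PEquiv.toMatrix_apply]
    by_cases hij : σ i = j
    · subst hij; simp [h]
    · simp [hij]
  have hDD : diagonal (star D) * diagonal D = 1 := by
    rw [diagonal_mul_diagonal, ← diagonal_one]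
    congr 1
    ext i
    rw [Pi.star_apply, mul_comm, hD]
  refine ⟨P, P * diagonal D, hPs, ⟨?_, ?_⟩, ?_⟩
  · rw [star_mul, hPs.star_eq, star_eq_conjTranspose, diagonal_conjTranspose, hcomm]
  · calc P * diagonal D * (P * diagonal D)
        = diagonal (star D) * (P * P) * diagonal D := by 
          nth_rw 1 [← hcomm]; simp only [mul_assoc]
      _ = 1 := by rw [hPs.mul_self, mul_one, hDD]
  · rw [← mul_assoc, hPs.mul_self, one_mul]

/-- The matrix on `ℂ^ι ⊗ ℂ²` which acts as `M k` on the `k`-th copy of `ℂ²`. -/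
def blockSum {ι : Type*} [DecidableEq ι] (M : ι → Matrix (Fin 2) (Fin 2) ℂ) :
    Matrix (ι ⊕ ι) (ι ⊕ ι) ℂ :=
  fromBlocks (diagonal fun k => M k 0 0) (diagonal fun k => M k 0 1)
    (diagonal fun k => M k 1 0) (diagonal fun k => M k 1 1)

section BlockSum

variable {ι : Type*} [DecidableEq ι]

theorem blockSum_mul [Fintype ι] (M N : ι → Matrix (Fin 2) (Fin 2) ℂ) :
    blockSum (fun k => M k * N k) = blockSum M * blockSum N := by
  simp only [blockSum, fromBlocks_multiply, diagonal_mul_diagonal, diagonal_add, mul_apply,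
    Fin.sum_univ_two]

theorem blockSum_star (M : ι → Matrix (Fin 2) (Fin 2) ℂ) :
    blockSum (fun k => star (M k)) = star (blockSum M) := by
  simp only [blockSum, star_eq_conjTranspose, fromBlocks_conjTranspose, diagonal_conjTranspose,
    conjTranspose_apply]
  rfl

theorem blockSum_one : blockSum (fun _ : ι => 1) = 1 := by
  simp [blockSum]

theorem blockSum_diag (a b : ι → ℂ) :
    blockSum (fun k => !![a k, 0; 0, b k]) = diagonal (Sum.elim a b) := by
  simp [blockSum, fromBlocks_diagonal]

end BlockSum

theorem twoScalarSum_eq (r s : ℕ) (α β : ℂ) :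
    twoScalarSum r s α β = diagonal (Sum.elim (fun _ => α) (fun _ => β)) := by
  rw [twoScalarSum, ← fromBlocks_diagonal, smul_one_eq_diagonal, smul_one_eq_diagonal]

theorem mem_symProducts_three {A : Type*} [Monoid A] [Star A] {V : A} :
    V ∈ symProducts 3 A ↔
      ∃ J K L : A, IsSymmetry J ∧ IsSymmetry K ∧ IsSymmetry L ∧ V = J * (K * L) := by
  constructor
  · rintro ⟨J, hJ, rfl⟩
    exact ⟨J 0, J 1, J 2, hJ 0, hJ 1, hJ 2, by simp [List.ofFn_succ]⟩
  · rintro ⟨J, K, L, hJ, hK, hL, rfl⟩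
    refine ⟨![J, K, L], fun i => ?_, by simp [List.ofFn_succ]⟩
    fin_cases i
    exacts [hJ, hK, hL]

theorem twoScalarSum_mem_symProducts_three {r : ℕ} {α β : ℂ} (hα : ‖α‖ = 1) (hβ : ‖β‖ = 1)
    (hαβ : α ≠ β) {z w : Fin r → ℂ} (hz : ∀ k, ‖z k‖ = 1) (hw : ∀ k, ‖w k‖ = 1)
    (hzw : ∀ k, z k * w k = -(α * β)) (hle : ∀ k, ‖z k + w k‖ ≤ ‖α - β‖)
    {σ : Equiv.Perm (Fin r ⊕ Fin r)} (hσ : Function.Involutive σ)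
    (h : ∀ i, Sum.elim z w (σ i) = star (Sum.elim z w i)) :
    twoScalarSum r r α β ∈ symProducts 3 (Matrix (Fin r ⊕ Fin r) (Fin r ⊕ Fin r) ℂ) := by
  have hex := fun k => Matrix.exists_isSymmetry_mul_eq hα hβ hαβ (hz k) (hw k) (hzw k) (hle k)
  choose J U hJ hU hJU using hex
  have hD : ∀ i, Sum.elim z w i * star (Sum.elim z w i) = 1 := by
    have hstar : ∀ {x : ℂ}, ‖x‖ = 1 → x * star x = 1 := fun {x} hx => by
      have : x * star x = (‖x‖ : ℂ) ^ 2 := Complex.mul_conj' _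
      rw [this, hx]; simp
    rintro (k | k)
    exacts [hstar (hz k), hstar (hw k)]
  obtain ⟨K, L, hK, hL, hKL⟩ := Matrix.exists_isSymmetry_diagonal_eq_mul hD hσ h
  have hUU : blockSum U * star (blockSum U) = 1 := by
    rw [← blockSum_star, ← blockSum_mul, ← blockSum_one]
    exact congrArg _ (funext fun k => mem_unitaryGroup_iff.1 (hU k))
  have hUU' : star (blockSum U) * blockSum U = 1 := mul_eq_one_comm.1 hUU
  have hJs : IsSymmetry (blockSum J) := by
    constructor
    · rw [← blockSum_star]
      exact congrArg _ (funext fun k => (hJ k).star_eq)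
    · rw [← blockSum_mul, ← blockSum_one]
      exact congrArg _ (funext fun k => (hJ k).mul_self)
  have hmain : blockSum J * twoScalarSum r r α β
      = blockSum U * diagonal (Sum.elim z w) * star (blockSum U) := by
    rw [twoScalarSum_eq, ← blockSum_diag, ← blockSum_diag, ← blockSum_star, ← blockSum_mul,
      ← blockSum_mul, ← blockSum_mul]
    exact congrArg _ (funext hJU)
  refine mem_symProducts_three.2 ⟨_, _, _, hJs, hK.conj hUU' hUU, hL.conj hUU' hUU, ?_⟩
  calc twoScalarSum r r α β = blockSum J * (blockSum J * twoScalarSum r r α β) := by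
        rw [← mul_assoc, hJs.mul_self, one_mul]
    _ = blockSum J * (blockSum U * (K * (star (blockSum U) * blockSum U) * L)
          * star (blockSum U)) := by
        rw [hmain, hKL, hUU', mul_one]
    _ = _ := by simp only [mul_assoc]

/-- Each `z (k + 1)` is matched with the conjugate stored at index `k`. The leftovers `z 0` and
`star (z (n + 1))` are fixed if real, or swapped if `z (n + 1) = z 0`. -/
theorem exists_involutive_conj {n : ℕ} {z : ℕ → ℂ}
    (h : (star (z 0) = z 0 ∧ star (z (n + 1)) = z (n + 1)) ∨ z (n + 1) = z 0) :
    ∃ σ : Equiv.Perm (Fin (n + 1) ⊕ Fin (n + 1)), Function.Involutive σ ∧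
      ∀ i, Sum.elim (fun k : Fin (n + 1) => z k) (fun k : Fin (n + 1) => star (z (k + 1))) (σ i)
        = star (Sum.elim (fun k : Fin (n + 1) => z k)
          (fun k : Fin (n + 1) => star (z (k + 1))) i) := by
  have build : ∀ a b : Fin (n + 1) ⊕ Fin (n + 1),
      (a = .inl 0 ∧ b = .inr (Fin.last n)) ∨ (a = .inr (Fin.last n) ∧ b = .inl 0) →
      ∃ f : Fin (n + 1) ⊕ Fin (n + 1) → Fin (n + 1) ⊕ Fin (n + 1), Function.Involutive f ∧
        f (.inl 0) = a ∧ f (.inr (Fin.last n)) = b ∧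
        (∀ k : Fin n, f (.inl k.succ) = .inr k.castSucc) ∧
        ∀ k : Fin n, f (.inr k.castSucc) = .inl k.succ := by
    intro a b hab
    refine ⟨Sum.elim (Fin.cases a fun k => .inr k.castSucc)
      (Fin.lastCases b fun k => .inl k.succ), ?_, by simp, by simp, by simp, by simp⟩
    rintro (k | k)
    · induction k using Fin.cases with
      | zero => rcases hab with ⟨rfl, rfl⟩ | ⟨rfl, rfl⟩ <;> simp
      | succ k => simp
    · induction k using Fin.lastCases with
      | last => rcases hab with ⟨rfl, rfl⟩ | ⟨rfl, rfl⟩ <;> simp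
      | cast k => simp
  rcases h with ⟨h0, h1⟩ | h
  · obtain ⟨f, hf, fa, fb, fc, fd⟩ := build _ _ (Or.inl ⟨rfl, rfl⟩)
    refine ⟨hf.toPerm, hf, ?_⟩
    simp only [Function.Involutive.coe_toPerm]
    rintro (k | k)
    · induction k using Fin.cases with
      | zero => simpa [fa] using h0.symm
      | succ k => simp [fc]
    · induction k using Fin.lastCases with
      | last => simpa [fb] using h1
      | cast k => simp [fd]
  · obtain ⟨f, hf, fa, fb, fc, fd⟩ := build _ _ (Or.inr ⟨rfl, rfl⟩)
    refine ⟨hf.toPerm, hf, ?_⟩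
    simp only [Function.Involutive.coe_toPerm]
    rintro (k | k)
    · induction k using Fin.cases with
      | zero => simp [fa, h]
      | succ k => simp [fc]
    · induction k using Fin.lastCases with
      | last => simp [fb, h]
      | cast k => simp [fd]

/-! ### The criterion and its reformulations -/

theorem ConditionP.twoScalarSum_mem {r : ℕ} (hr : 2 ≤ r) {α β : ℂ} (hα : ‖α‖ = 1)
    (hβ : ‖β‖ = 1) (hαβ : α ≠ β) (h : ConditionP r r α β)
    (hle : 2 * Real.cos (Real.pi / r / 2) ≤ ‖α - β‖) :
    twoScalarSum r r α β ∈ symProducts 3 (Matrix (Fin r ⊕ Fin r) (Fin r ⊕ Fin r) ℂ) := by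
  have hβ0 : β ≠ 0 := by rintro rfl; simp at hβ
  have hα0 : α ≠ 0 := by rintro rfl; simp at hα
  -- With `z k = u * ω ^ k` and `w k = star (z (k + 1))`, this ratio is what makes `z k * w k =
  -- -αβ`.
  obtain ⟨ω, hω⟩ : ∃ ω : ℂ, ω = -(α * β)⁻¹ := ⟨_, rfl⟩
  have hω1 : ‖ω‖ = 1 := by simp [hω, hα, hβ]
  have hωr : ω ^ r = -1 ∨ (ω ^ r = 1 ∧ Odd r) := by
    have e : ω ^ r = (-1) ^ r * ((α * β) ^ r)⁻¹ := by rw [hω, neg_pow, inv_pow]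
    rcases Nat.even_or_odd r with hev | hodd
    · left
      rw [e, h.det_eq_neg_one_of_even (by omega) hev, hev.neg_one_pow]; norm_num
    · have hdet := h.det_real
      rw [← mul_pow] at hdet
      rcases hdet with hd | hd
      · right; refine ⟨?_, hodd⟩
        rw [e, hd, hodd.neg_one_pow]; norm_num
      · left; rw [e, hd, hodd.neg_one_pow]; norm_num
  have main : ∀ u : ℂ, ‖u‖ = 1 → (u ^ 2) ^ r * ω ^ r = -1 → (ω ^ r) ^ 2 = 1 →
      ((star u = u ∧ star (u * ω ^ r) = u * ω ^ r) ∨ u * ω ^ r = u) →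
      twoScalarSum r r α β ∈ symProducts 3 (Matrix (Fin r ⊕ Fin r) (Fin r ⊕ Fin r) ℂ) := by
    intro u hu hur hω2 hends
    set z : ℕ → ℂ := fun k => u * ω ^ k with hz
    have hz1 : ∀ k, ‖z k‖ = 1 := fun k => by simp [hz, hu, hω1]
    have hz0 : ∀ k, z k ≠ 0 := fun k h0 => by simpa [h0] using hz1 k
    have hstar : ∀ k, star (z k) = (z k)⁻¹ := fun k => (Complex.inv_eq_conj (hz1 k)).symm
    have hsucc : ∀ k, z (k + 1) = z k * ω := fun k => by simp only [hz]; ring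
    have hω0 : ω ≠ 0 := by intro h0; simp [h0] at hω1
    obtain ⟨n, rfl⟩ : ∃ n, r = n + 1 := ⟨r - 1, by omega⟩
    obtain ⟨σ, hσ, hσz⟩ := exists_involutive_conj (n := n) (z := z) (by simpa [hz] using hends)
    refine twoScalarSum_mem_symProducts_three hα hβ hαβ (z := fun k => z k)
      (w := fun k => star (z (k + 1))) (fun k => hz1 k) (fun k => by rw [norm_star, hz1])
      (fun k => ?_) (fun k => ?_) hσ hσz
    · have := hz0 k
      rw [hstar, hsucc, hω]
      field_simp
    · refine le_trans ?_ hle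
      have e : z k + star (z (k + 1)) = (z (k + 1))⁻¹ * (1 + z k * z (k + 1)) := by
        have := hz0 (k + 1)
        rw [hstar, mul_add, mul_one, mul_left_comm, inv_mul_cancel₀ this, mul_one, add_comm]
      rw [e, norm_mul, norm_inv, hz1, inv_one, one_mul]
      refine norm_one_add_le_of_pow_eq_neg_one (by omega) ?_
      have e2 : z k * z (k + 1) = u ^ 2 * ω * (ω ^ 2) ^ (k : ℕ) := by
        simp only [hz]; ring
      have e3 : ((ω ^ 2) ^ (k : ℕ)) ^ (n + 1) = ((ω ^ (n + 1)) ^ 2) ^ (k : ℕ) := by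
        simp only [← pow_mul]
        congr 1; ring
      rw [e2, mul_pow, mul_pow, e3, hur, hω2, one_pow, mul_one]
  -- If `ω ^ r = -1`, the start `u = 1` gives real ends `1, -1`. If `ω ^ r = 1` with `r` odd, the
  -- progression closes up, and `u = I` supplies `(u ^ 2) ^ r = -1`.
  rcases hωr with hω' | ⟨hω', hodd⟩
  · refine main 1 (by simp) (by simp [hω']) (by simp [hω']) (Or.inl ?_)
    simp [hω']
  · refine main Complex.I (by simp) (by simp [hω', hodd.neg_one_pow]) (by simp [hω']) (Or.inr ?_)
    simp [hω']

theorem ConditionP.two_mul_cos_le_of_mem {r : ℕ} (hr : 2 ≤ r) {α β : ℂ} (hα : ‖α‖ = 1)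
    (hβ : ‖β‖ = 1) (h : ConditionP r r α β)
    (hmem : twoScalarSum r r α β ∈ symProducts 3 (Matrix (Fin r ⊕ Fin r) (Fin r ⊕ Fin r) ℂ)) :
    2 * Real.cos (Real.pi / r / 2) ≤ ‖α - β‖ := by
  obtain ⟨J, K, L, hJ, hK, hL, hV⟩ := mem_symProducts_three.1 hmem
  have : NeZero r := ⟨by omega⟩
  set φ := toEuclideanCLM (n := Fin r ⊕ Fin r) (𝕜 := ℂ)
  have hφ : ∀ {A : Matrix (Fin r ⊕ Fin r) (Fin r ⊕ Fin r) ℂ}, IsSymmetry A → IsSymmetry (φ A) :=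
    fun {A} hA => ⟨by rw [← map_star, hA.star_eq], by rw [← map_mul, hA.mul_self, map_one]⟩
  have hstar : ∀ {x : ℂ}, ‖x‖ = 1 → star x * x = 1 := fun {x} hx => by
    have : star x * x = (‖x‖ : ℂ) ^ 2 := Complex.conj_mul' _
    rw [this, hx]; simp
  refine h.two_mul_cos_le_of_eq_mul hr hα hβ (hφ hJ) (hφ hK) (hφ hL)
    (V := φ (twoScalarSum r r α β)) ?_ ?_ ?_
  · rw [← map_star, ← map_mul, ← map_one φ, twoScalarSum_eq, star_eq_conjTranspose,
      diagonal_conjTranspose, diagonal_mul_diagonal, ← diagonal_one]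
    congr 2
    ext i
    rcases i with i | i
    exacts [hstar hα, hstar hβ]
  · rw [← map_one φ, ← map_mul, ← map_smul, ← map_smul, ← map_sub, twoScalarSum_eq,
      diagonal_mul_diagonal, ← diagonal_one, ← diagonal_smul, ← diagonal_smul, diagonal_sub]
    congr 2
    ext i
    rcases i with i | i <;> simp <;> ring
  · rw [← map_mul, ← map_mul, ← hV]

theorem ConditionP.mem_symProducts_three_iff {r : ℕ} (hr : 2 ≤ r) {α β : ℂ} (hα : ‖α‖ = 1)
    (hβ : ‖β‖ = 1) (hαβ : α ≠ β) (h : ConditionP r r α β) :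
    twoScalarSum r r α β ∈ symProducts 3 (Matrix (Fin r ⊕ Fin r) (Fin r ⊕ Fin r) ℂ) ↔
      2 * Real.cos (Real.pi / r / 2) < ‖α - β‖ :=
  ⟨fun hm => (h.two_mul_cos_le_of_mem hr hα hβ hm).lt_of_ne (h.norm_sub_ne hr hα hβ),
    fun hlt => h.twoScalarSum_mem hr hα hβ hαβ hlt.le⟩

/-- The numbers `(α/β) (αβ)^(2j)` for `0 ≤ j < r` form a regular `r`-gon, one vertex of which is far
enough from `1`. The vertex `j = 0` has distance exactly `‖α - β‖`, and the hypothesis covers the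
others. -/
theorem ConditionP.two_mul_cos_lt_of_forall {r : ℕ} (hr : 2 ≤ r) {α β : ℂ} (hα : ‖α‖ = 1)
    (hβ : ‖β‖ = 1) (h : ConditionP r r α β)
    (hj : ∀ j : ℕ, 1 ≤ j → j ≤ r - 1 → ‖1 - α ^ (2 * j + 1) * β ^ (2 * j - 1)‖ < ‖α - β‖) :
    2 * Real.cos (Real.pi / r / 2) < ‖α - β‖ := by
  refine lt_of_le_of_ne ?_ (h.norm_sub_ne hr hα hβ)
  have hβ0 : β ≠ 0 := by rintro rfl; simp at hβ
  obtain ⟨k, hk, hck⟩ := (h.isPrimitiveRoot (by omega)).exists_le_norm_one_sub_mul_pow (by omega)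
    (z := α / β) (by simp [hα, hβ])
  refine hck.trans ?_
  rcases k with _ | k
  · have e : 1 - α / β * ((α * β) ^ 2) ^ 0 = -(α - β) / β := by field_simp; ring
    rw [e, norm_div, hβ, div_one, norm_neg]
  · have e : α / β * ((α * β) ^ 2) ^ (k + 1) = α ^ (2 * (k + 1) + 1) * β ^ (2 * (k + 1) - 1) := by
      rw [show 2 * (k + 1) - 1 = 2 * k + 1 by omega]
      field_simp; ring
    rw [e]
    exact (hj (k + 1) (by omega) (by omega)).le

theorem theorem3p25 (d r : ℕ) (hd : 4 ≤ d) (hdr : d = r + r)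
    (α β : ℂ) (hα : ‖α‖ = 1) (hβ : ‖β‖ = 1) (hαβ : α ≠ β) (hP : ConditionP r r α β) :
    twoScalarSum r r α β ∈ symProducts 3 (Matrix (Fin r ⊕ Fin r) (Fin r ⊕ Fin r) ℂ) ↔
      ((4 ∣ d ∧ (α * β) ^ r = -1 ∧
          ‖Complex.exp (Complex.I * (((r : ℂ) - 1) / (r : ℂ)) * (Real.pi : ℂ)) - 1‖ < ‖α - β‖) ∨
        (¬ 4 ∣ d ∧
          ‖Complex.exp (Complex.I * (((r : ℂ) - 1) / (r : ℂ)) * (Real.pi : ℂ)) - 1‖ < ‖α - β‖) ∨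
        (¬ 4 ∣ d ∧ (α * β) ^ r = -1 ∧
          ∀ j : ℕ, 1 ≤ j → j ≤ r - 1 →
            ‖1 - α ^ (2 * j + 1) * β ^ (2 * j - 1)‖ < ‖α - β‖)) := by
  have hr : 2 ≤ r := by omega
  rw [hP.mem_symProducts_three_iff hr hα hβ hαβ, norm_exp_sub_one_eq_two_mul_cos (by omega)]
  constructor
  · intro hlt
    by_cases h4 : 4 ∣ d
    · exact Or.inl ⟨h4, hP.det_eq_neg_one_of_even (by omega)
        (Nat.even_iff.2 (by omega)), hlt⟩
    · exact Or.inr (Or.inl ⟨h4, hlt⟩)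
  · rintro (⟨-, -, hlt⟩ | ⟨-, hlt⟩ | ⟨-, -, hj⟩)
    · exact hlt
    · exact hlt
    · exact hP.two_mul_cos_lt_of_forall hr hα hβ hj
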